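/- All graphs are finite and simple. For a graph $G$ let $N[v]$ be the closed neighbourhood of the vertex $v$. A sequence $(v_1,\dots,v_k)$ of distinct vertices of $G$ is a \emph{legal dominating sequence} if $\{v_1,\dots,v_k\}$ is a dominating set of $G$ and $N[v_i]\setminus\bigcup_{j<i}N[v_j]\neq\emptyset$ for every $i\in\{1,\dots,k\}$. The \emph{Grundy domination number} $\gamma_{gr}(G)$ is the maximum length of a legal dominating sequence of $G$. Let $P_n^m$ be the $m$-th power of the path $P_n$ with $n$ vertices, that is, the graph on $V(P_n)$ in which two distinct vertices are adjacent if their distance in $P_n$ is at most $m$. The \emph{lexicographic product} $G\circ H$ is the graph with vertex set $V(G)\times V(H)$ in which $(g_1,h_1)$ and $(g_2,h_2)$ are adjacent if either $g_1g_2\in E(G)$, or $g_1=g_2$ and $h_1h_2\in E(H)$. **Theorem.** Let $n,m$ be integers with $m\ge 0$ and $n\ge m+2$. For every graph $H$ with at least one vertex, $$\gamma_{gr}(P_n^m\circ H)=\begin{cases}\left\lceil \dfrac{n}{m+1}\right\rceil\bigl(\gamma_{gr}(H)-(m+1)\bigr)+n+m & \text{if } \gamma_{gr}(H)\ge m+1,\\[2mm]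 2\gamma_{gr}(H)+n-m-2 & \text{if } \gamma_{gr}(H)\le m.\end{cases}$$ Moreover, $\gamma_{gr}(P_n^m)=n-m$. -/

import Mathlib

namespace GrundyDomination

/-- The closed neighbourhood `N[v]` of a vertex. -/
def closedNeighborSet {V : Type*} (G : SimpleGraph V) (v : V) : Set V :=
  insert v (G.neighborSet v)

/-- `D` is a dominating set: it meets `N[v]` for every vertex `v`. -/
def IsDominatingSet {V : Type*} (G : SimpleGraph V) (D : Set V) : Prop :=
  ∀ v : V, (D ∩ closedNeighborSet G v).Nonempty

/-- The private neighbourhood of the `i`-th vertex of a sequence `S`: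
`N[vᵢ] \ ⋃_{j < i} N[vⱼ]`. -/
def privateNeighborhood {V : Type*} (G : SimpleGraph V) (S : List V) (i : Fin S.length) :
    Set V :=
  closedNeighborSet G (S.get i) \ ⋃ j : Fin S.length, ⋃ _ : j < i, closedNeighborSet G (S.get j)

/-- A legal dominating sequence of `G`: a sequence of distinct vertices whose set of vertices is
dominating and in which every vertex has a nonempty private neighbourhood. -/
structure IsLegalDominatingSequence {V : Type*} (G : SimpleGraph V) (S : List V) : Prop where
  nodup : S.Nodup
  dominating : IsDominatingSet G {v | v ∈ S}
  private_nonempty : ∀ i : Fin S.length, (privateNeighborhood G S i).Nonempty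

/-- The Grundy domination number of a finite graph: the maximum length of a legal dominating
sequence (see `grundyDominationNumber_isGreatest`). -/
noncomputable def grundyDominationNumber {V : Type*} (G : SimpleGraph V) : ℕ :=
  sSup {k : ℕ | ∃ S : List V, IsLegalDominatingSequence G S ∧ S.length = k}

/-- Every finite graph has a legal dominating sequence. -/
theorem exists_isLegalDominatingSequence {V : Type*} [Finite V] (G : SimpleGraph V) :
    ∃ S : List V, IsLegalDominatingSequence G S := by
  classical
  have := Fintype.ofFinite V
  let P : ℕ → Prop := fun k => ∃ S : List V,
    (S.Nodup ∧ ∀ i : Fin S.length, (privateNeighborhood G S i).Nonempty) ∧ S.length = k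
  have hP0 : P 0 := ⟨[], ⟨List.nodup_nil, fun i => i.elim0⟩, rfl⟩
  obtain ⟨S, ⟨hnd, hpr⟩, hlen⟩ := Nat.findGreatest_spec (Nat.zero_le (Fintype.card V)) hP0
  refine ⟨S, hnd, ?_, hpr⟩
  by_contra hdom
  simp only [IsDominatingSet, not_forall, Set.not_nonempty_iff_eq_empty] at hdom
  obtain ⟨v, hv⟩ := hdom
  have hv' : ∀ u ∈ S, u ∉ closedNeighborSet G v := fun u hu hu' =>
    (Set.eq_empty_iff_forall_notMem.mp hv) u ⟨hu, hu'⟩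
  have hvS : v ∉ S := fun h => hv' v h (Set.mem_insert _ _)
  have hnd' : (S ++ [v]).Nodup := by
    rw [List.nodup_append]
    refine ⟨hnd, List.nodup_singleton v, ?_⟩
    rintro a ha b hb rfl
    rw [List.mem_singleton] at hb
    exact hvS (hb ▸ ha)
  have hP : P (S.length + 1) := by
    refine ⟨S ++ [v], ⟨hnd', ?_⟩, by simp⟩
    intro i
    by_cases hi : i.val < S.length
    · obtain ⟨x, hx1, hx2⟩ := hpr ⟨i.val, hi⟩
      refine ⟨x, ?_, ?_⟩
      · simpa [List.getElem_append_left hi] using hx1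
      · simp only [Set.mem_iUnion, not_exists] at hx2 ⊢
        intro j hj hxj
        have hj' : j.val < S.length := lt_trans hj hi
        refine hx2 ⟨j.val, hj'⟩ hj ?_
        simpa [List.getElem_append_left hj'] using hxj
    · have hi' : i.val = S.length := by
        have := i.isLt
        simp only [List.length_append, List.length_singleton] at this
        omega
      refine ⟨v, ?_, ?_⟩
      · have : (S ++ [v]).get i = v := by simp [hi']
        rw [this]
        exact Set.mem_insert _ _
      · simp only [Set.mem_iUnion, not_exists]
        intro j hj hvj
        have hj' : j.val < S.length := by rw [← hi']; exact hj
        have hget : (S ++ [v]).get j = S[j.val] := by simp [List.getElem_append_left hj']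
        rw [hget] at hvj
        refine hv' S[j.val] (List.getElem_mem hj') ?_
        rcases hvj with h | h
        · exact Or.inl h.symm
        · exact Or.inr (SimpleGraph.Adj.symm h)
  have hle : S.length + 1 ≤ Fintype.card V := by
    simpa using hnd'.length_le_card
  have := Nat.le_findGreatest (P := P) hle hP
  omega

/-- The supremum that defines the Grundy domination number of a finite graph is attained. -/
theorem grundyDominationNumber_isGreatest {V : Type*} [Finite V] (G : SimpleGraph V) :
    IsGreatest {k : ℕ | ∃ S : List V, IsLegalDominatingSequence G S ∧ S.length = k}
      (grundyDominationNumber G) := by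
  have := Fintype.ofFinite V
  have hbdd : BddAbove {k : ℕ | ∃ S : List V, IsLegalDominatingSequence G S ∧ S.length = k} := by
    refine ⟨Fintype.card V, ?_⟩
    rintro k ⟨S, hS, rfl⟩
    exact hS.nodup.length_le_card
  obtain ⟨S, hS⟩ := exists_isLegalDominatingSequence G
  exact ⟨Nat.sSup_mem ⟨_, S, hS, rfl⟩ hbdd, fun k hk => le_csSup hbdd hk⟩

/-- The `m`-th power of `G`: distinct vertices are adjacent when their distance in `G` is at
most `m`. The extended distance makes vertices of different components non-adjacent. -/
def graphPower {V : Type*} (G : SimpleGraph V) (m : ℕ) : SimpleGraph V where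
  Adj u v := u ≠ v ∧ G.edist u v ≤ (m : ℕ∞)
  symm := ⟨fun u v h => ⟨h.1.symm, by rw [SimpleGraph.edist_comm]; exact h.2⟩⟩
  loopless := ⟨fun _ h => h.1 rfl⟩

/-- The lexicographic product `G ∘ H`. -/
def lexProduct {V W : Type*} (G : SimpleGraph V) (H : SimpleGraph W) : SimpleGraph (V × W) where
  Adj x y := G.Adj x.1 y.1 ∨ (x.1 = y.1 ∧ H.Adj x.2 y.2)
  symm := ⟨fun _ _ h => h.imp (fun h => SimpleGraph.Adj.symm h) (fun h => ⟨h.1.symm, SimpleGraph.Adj.symm h.2⟩)⟩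
  loopless := ⟨fun _ h => h.elim (fun h => G.irrefl h) (fun h => H.irrefl h.2)⟩

/-- `P_n^m`, the `m`-th power of the path with `n` vertices. -/
def pathPower (n m : ℕ) : SimpleGraph (Fin n) :=
  graphPower (SimpleGraph.pathGraph n) m

end GrundyDomination

namespace GrundyDomination

/-! Write `k` for the Grundy domination number of `H`. Attach to each vertex of a legal sequence of
`P_n^m ∘ H` a footprint, a vertex that it is the first to dominate. A layer visited before all
adjacent layers is fresh. Footprints divide into those charged to a fresh layer, at most `k` per
layer, and those that lie in a layer not visited before and different from the vertex's own
(`IsFootprinted.card_le_of_lexProduct`).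

With `a + 1` fresh layers and `s` footprints of the second kind, the length is at most `(a + 1) * k
+ s`. Between consecutive fresh layers the `m` positions next to the earlier visited one carry no
footprint of the second kind, so `s + a * (m + 1) < n`. The closed neighbourhood of the first
position carries none either, so `s + m < n` (`card_add_le_of_footprint_pathPower`).

Conversely, visiting `0, …, r` and then jumping by `m + 1` for `q ≥ 1` steps to `n - 1` yields `(q +
1) * k + r`. Trading `m + 1` single vertices for a fresh layer changes the bound by `k - (m + 1)`:
if this is nonnegative the largest possible `q` is optimal, otherwise `q = 1`. -/

theorem mem_closedNeighborSet {V : Type*} {G : SimpleGraph V} {v x : V} :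
    x ∈ closedNeighborSet G v ↔ x = v ∨ G.Adj v x := Iff.rfl

theorem mem_closedNeighborSet_self {V : Type*} (G : SimpleGraph V) (v : V) :
    v ∈ closedNeighborSet G v := Or.inl rfl

/-! ### Footprinted families and legal dominating sequences -/

/-- The vertex `x i` is footprinted by `v i`: it lies in `N[v i]` and in no earlier `N[v j]`. -/
structure IsFootprinted {ι V : Type*} [LT ι] (G : SimpleGraph V) (v x : ι → V) : Prop where
  mem : ∀ i, x i ∈ closedNeighborSet G (v i)
  notMem : ∀ i j, j < i → x i ∉ closedNeighborSet G (v j)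

theorem IsFootprinted.injective {ι V : Type*} [LinearOrder ι] {G : SimpleGraph V} {v x : ι → V}
    (h : IsFootprinted G v x) : Function.Injective v := by
  intro i j hij
  rcases lt_trichotomy i j with hlt | heq | hlt
  · exact (h.notMem j i hlt (hij ▸ h.mem j)).elim
  · exact heq
  · exact (h.notMem i j hlt (hij ▸ h.mem i)).elim

theorem IsFootprinted.comp {ι κ V : Type*} [LinearOrder ι] [LinearOrder κ] {G : SimpleGraph V}
    {v x : ι → V} (h : IsFootprinted G v x) {e : κ → ι} (he : StrictMono e) :
    IsFootprinted G (v ∘ e) (x ∘ e) :=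
  ⟨fun i => h.mem (e i), fun i j hji => h.notMem (e i) (e j) (he hji)⟩

theorem IsFootprinted.isLegalDominatingSequence {V : Type*} {G : SimpleGraph V} {k : ℕ}
    {v x : Fin k → V} (h : IsFootprinted G v x) (hdom : IsDominatingSet G (Set.range v)) :
    IsLegalDominatingSequence G (List.ofFn v) := by
  refine ⟨List.nodup_ofFn.mpr h.injective, ?_, ?_⟩
  · intro u
    obtain ⟨w, ⟨i, rfl⟩, hw⟩ := hdom u
    exact ⟨v i, by simp, hw⟩
  · intro i
    refine ⟨x (i.cast (List.length_ofFn ..)), ?_, ?_⟩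
    · rw [List.get_ofFn]
      exact h.mem _
    · simp only [Set.mem_iUnion, not_exists]
      intro j hj
      rw [List.get_ofFn]
      exact h.notMem _ _ hj

theorem IsLegalDominatingSequence.exists_isFootprinted {V : Type*} {G : SimpleGraph V}
    {S : List V} (h : IsLegalDominatingSequence G S) :
    ∃ x : Fin S.length → V, IsFootprinted G S.get x := by
  choose x hx using h.private_nonempty
  refine ⟨x, fun i => (hx i).1, fun i j hji hmem => (hx i).2 ?_⟩
  simp only [Set.mem_iUnion]
  exact ⟨j, hji, hmem⟩

theorem exists_isFootprinted_grundyDominationNumber {V : Type*} [Finite V] (G : SimpleGraph V) :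
    ∃ v x : Fin (grundyDominationNumber G) → V, IsFootprinted G v x := by
  obtain ⟨S, hS, hlen⟩ := (grundyDominationNumber_isGreatest G).1
  obtain ⟨x, hx⟩ := hS.exists_isFootprinted
  rw [← hlen]
  exact ⟨S.get, x, hx⟩

/-- A footprinted family need not dominate to bound the Grundy domination number from below. -/
theorem IsFootprinted.card_le {ι V : Type*} [LinearOrder ι] [Fintype ι] [Finite V]
    {G : SimpleGraph V} {v x : ι → V} (h : IsFootprinted G v x) :
    Fintype.card ι ≤ grundyDominationNumber G := by
  classical
  have := Fintype.ofFinite V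
  let P : ℕ → Prop := fun k => ∃ v x : Fin k → V, IsFootprinted G v x
  have hbdd : ∀ k, P k → k ≤ Fintype.card V := by
    rintro k ⟨v, x, hvx⟩
    simpa using Fintype.card_le_of_injective v hvx.injective
  have hι : P (Fintype.card ι) :=
    ⟨_, _, h.comp (Fintype.orderIsoFinOfCardEq ι rfl).strictMono⟩
  obtain ⟨w, y, hwy⟩ := Nat.findGreatest_spec (hbdd _ hι) hι
  refine (Nat.le_findGreatest (hbdd _ hι) hι).trans
    ((grundyDominationNumber_isGreatest G).2
      ⟨_, hwy.isLegalDominatingSequence ?_, List.length_ofFn ..⟩)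
  -- A longest footprinted family dominates: an undominated `u` could be appended, footprinting
  -- itself.
  by_contra hdom
  simp only [IsDominatingSet, not_forall, Set.not_nonempty_iff_eq_empty] at hdom
  obtain ⟨u, hu⟩ := hdom
  have hu' : ∀ i, u ∉ closedNeighborSet G (w i) := by
    intro i hi
    refine (Set.eq_empty_iff_forall_notMem.mp hu) (w i) ⟨⟨i, rfl⟩, ?_⟩
    exact hi.imp Eq.symm SimpleGraph.Adj.symm
  have hP : P (Nat.findGreatest P (Fintype.card V) + 1) := by
    refine ⟨Fin.snoc w u, Fin.snoc y u, ?_, ?_⟩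
    · intro i
      refine Fin.lastCases ?_ (fun i => ?_) i
      · simpa using mem_closedNeighborSet_self G u
      · simpa using hwy.mem i
    · intro i j hji
      induction j using Fin.lastCases with
      | last => exact absurd (Fin.le_last i) hji.not_ge
      | cast j =>
        induction i using Fin.lastCases with
        | last => simpa using hu' j
        | cast i => simpa using hwy.notMem i j (by simpa using hji)
  have := Nat.le_findGreatest (hbdd _ hP) hP
  omega

theorem grundyDominationNumber_pos {V : Type*} [Finite V] [Nonempty V] (G : SimpleGraph V) :
    0 < grundyDominationNumber G := by
  obtain ⟨u⟩ := ‹Nonempty V›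
  have h : IsFootprinted G (fun _ : Fin 1 => u) (fun _ => u) :=
    ⟨fun _ => mem_closedNeighborSet_self G u, fun i j hji => by omega⟩
  exact lt_of_lt_of_le (by simp) h.card_le

/-- The footprints can be chosen so that every vertex that is not yet dominated footprints
itself. -/
theorem IsFootprinted.exists_self {ι V : Type*} [LinearOrder ι] {G : SimpleGraph V} {v x : ι → V}
    (h : IsFootprinted G v x) :
    ∃ y : ι → V, IsFootprinted G v y ∧
      ∀ i, (∀ j < i, v i ∉ closedNeighborSet G (v j)) → y i = v i := by
  classical
  refine ⟨fun i => if ∀ j < i, v i ∉ closedNeighborSet G (v j) then v i else x i, ⟨?_, ?_⟩, ?_⟩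
  · intro i
    split_ifs
    · exact mem_closedNeighborSet_self G _
    · exact h.mem i
  · intro i j hji
    split_ifs with hi
    · exact hi j hji
    · exact h.notMem i j hji
  · intro i hi
    exact if_pos hi

/-! ### Lower bound for lexicographic products -/

theorem mem_closedNeighborSet_lexProduct {V W : Type*} {G : SimpleGraph V} {H : SimpleGraph W}
    {p q : V × W} : q ∈ closedNeighborSet (lexProduct G H) p ↔
      G.Adj p.1 q.1 ∨ (q.1 = p.1 ∧ q.2 ∈ closedNeighborSet H p.2) := by
  rw [mem_closedNeighborSet, mem_closedNeighborSet, Prod.ext_iff]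
  change _ ∨ (G.Adj p.1 q.1 ∨ p.1 = q.1 ∧ H.Adj p.2 q.2) ↔ _
  rw [eq_comm (a := p.1)]
  tauto

/-- Each vertex of a footprinted family of `G` contributes one vertex of `G ∘ H`, and those that
are adjacent to no earlier one contribute a whole Grundy dominating sequence of `H`. -/
theorem IsFootprinted.lexProduct_le {ι V W : Type*} [LinearOrder ι] [Fintype ι] [Finite V]
    [Finite W] [Nonempty W] {G : SimpleGraph V} {v x : ι → V} (h : IsFootprinted G v x)
    (H : SimpleGraph W) (A : Finset ι) (hA : ∀ i ∈ A, x i = v i) :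
    A.card * grundyDominationNumber H + Aᶜ.card ≤
      grundyDominationNumber (lexProduct G H) := by
  classical
  obtain ⟨w, y, hwy⟩ := exists_isFootprinted_grundyDominationNumber H
  obtain ⟨o⟩ := ‹Nonempty W›
  generalize grundyDominationNumber H = k at w y hwy ⊢
  -- Layers in `A` use the indices below `k`, the others only the index `k`, where `Fin.snoc` puts
  -- the arbitrary vertex `o`. The lexicographic order runs through the layers one after another.
  let κ : ι → Type := fun i => {j : Fin (k + 1) // if i ∈ A then j.1 < k else j.1 = k}
  let w' : Fin (k + 1) → W := Fin.snoc w o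
  let y' : Fin (k + 1) → W := Fin.snoc y o
  have hF : IsFootprinted (lexProduct G H) (ι := Σₗ i, κ i)
      (fun p => (v (ofLex p).1, w' (ofLex p).2.1)) (fun p => (x (ofLex p).1, y' (ofLex p).2.1)) := by
    have hself : ∀ j, y' j ∈ closedNeighborSet H (w' j) := by
      intro j
      refine Fin.lastCases ?_ (fun j => ?_) j
      · simpa [w', y'] using mem_closedNeighborSet_self H o
      · simpa [w', y'] using hwy.mem j
    refine ⟨fun p => ?_, fun p q hqp => ?_⟩
    · rw [mem_closedNeighborSet_lexProduct]
      rcases h.mem (ofLex p).1 with hp | hp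
      · exact Or.inr ⟨hp, hself _⟩
      · exact Or.inl hp
    · rw [mem_closedNeighborSet_lexProduct]
      obtain ⟨i, a⟩ := p
      obtain ⟨j, b⟩ := q
      rcases Sigma.Lex.lt_def.mp hqp with hlt | ⟨heq, hlt⟩
      · have := h.notMem i j hlt
        rw [mem_closedNeighborSet] at this
        change ¬ (G.Adj (v j) (x i) ∨ x i = v j ∧ _)
        tauto
      · change j = i at heq
        subst heq
        change b < a at hlt
        change ¬ (G.Adj (v j) (x j) ∨ x j = v j ∧ y' a.1 ∈ closedNeighborSet H (w' b.1))
        obtain ⟨⟨a, ha⟩, ha'⟩ := a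
        obtain ⟨⟨b, hb⟩, hb'⟩ := b
        have hlt' : b < a := hlt
        by_cases hj : j ∈ A
        · rw [if_pos hj] at ha' hb'
          have e := hwy.notMem ⟨a, ha'⟩ ⟨b, hb'⟩ hlt'
          have e1 : y' ⟨a, ha⟩ = y ⟨a, ha'⟩ := Fin.snoc_castSucc (α := fun _ => W) o y ⟨a, ha'⟩
          have e2 : w' ⟨b, hb⟩ = w ⟨b, hb'⟩ := Fin.snoc_castSucc (α := fun _ => W) o w ⟨b, hb'⟩
          rw [e1, e2, hA j hj]
          simp [e]
        · rw [if_neg hj] at ha' hb'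
          dsimp only at ha' hb'
          omega
  have hcard := hF.card_le
  have hκ : ∀ i, Fintype.card (κ i) = if i ∈ A then k else 1 := by
    intro i
    split_ifs with hi
    · rw [Fintype.card_eq.mpr ⟨(⟨fun j => ⟨j.1.1, by simpa [hi] using j.2⟩,
        fun j => ⟨j.castSucc, by simp [hi]⟩, fun j => rfl, fun j => rfl⟩ : κ i ≃ Fin k)⟩,
        Fintype.card_fin]
    · rw [Fintype.card_eq_one_iff]
      refine ⟨⟨Fin.last k, by simp [hi]⟩, fun j => Subtype.ext (Fin.ext ?_)⟩
      simpa [hi] using j.2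
  have hsum : Fintype.card (Σₗ i, κ i) = A.card * k + Aᶜ.card := by
    rw [show Fintype.card (Σₗ i, κ i) = Fintype.card (Σ i, κ i) from Fintype.card_congr ofLex,
      Fintype.card_sigma]
    simp only [hκ]
    rw [Finset.sum_ite]
    simp [Finset.filter_not, ← Finset.compl_eq_univ_sdiff]
  omega

/-! ### Adjacency in powers of paths -/

theorem pathGraph_edist_le_iff {n : ℕ} (m : ℕ) (u v : Fin n) :
    (SimpleGraph.pathGraph n).edist u v ≤ (m : ℕ∞) ↔ u.1 ≤ v.1 + m ∧ v.1 ≤ u.1 + m := by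
  constructor
  · intro h
    have hwalk : ∀ {a b : Fin n} (p : (SimpleGraph.pathGraph n).Walk a b),
        a.1 ≤ b.1 + p.length ∧ b.1 ≤ a.1 + p.length := by
      intro a b p
      induction p with
      | nil => simp
      | cons hadj p ih =>
        rw [SimpleGraph.pathGraph_adj] at hadj
        rw [SimpleGraph.Walk.length_cons]
        omega
    obtain ⟨p, hp⟩ := SimpleGraph.exists_walk_of_edist_ne_top
      (ne_top_of_le_ne_top (ENat.natCast_ne_top m) h)
    rw [← hp, Nat.cast_le] at h
    have := hwalk p
    omega
  · have hle : ∀ (d : ℕ) (a b : Fin n), b.1 = a.1 + d →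
        (SimpleGraph.pathGraph n).edist a b ≤ (d : ℕ∞) := by
      intro d
      induction d with
      | zero =>
        intro a b hab
        rw [Fin.ext (by omega : a.1 = b.1)]
        simp
      | succ d ih =>
        intro a b hab
        let c : Fin n := ⟨a.1 + d, by omega⟩
        have hcb : (SimpleGraph.pathGraph n).edist c b = 1 := by
          rw [SimpleGraph.edist_eq_one_iff_adj, SimpleGraph.pathGraph_adj]
          exact Or.inl hab.symm
        refine (SimpleGraph.edist_triangle (v := c)).trans ?_
        rw [hcb, Nat.cast_succ]
        exact add_le_add_left (ih a c rfl) 1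
    rintro ⟨h1, h2⟩
    rcases le_total u.1 v.1 with h | h
    · exact (hle (v.1 - u.1) u v (by omega)).trans (by exact_mod_cast (by omega))
    · rw [SimpleGraph.edist_comm]
      exact (hle (u.1 - v.1) v u (by omega)).trans (by exact_mod_cast (by omega))

theorem pathPower_adj {n m : ℕ} {u v : Fin n} :
    (pathPower n m).Adj u v ↔ u ≠ v ∧ u.1 ≤ v.1 + m ∧ v.1 ≤ u.1 + m :=
  and_congr_right fun _ => pathGraph_edist_le_iff m u v

theorem mem_closedNeighborSet_pathPower {n m : ℕ} {v x : Fin n} :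
    x ∈ closedNeighborSet (pathPower n m) v ↔ x.1 ≤ v.1 + m ∧ v.1 ≤ x.1 + m := by
  rw [mem_closedNeighborSet, pathPower_adj]
  by_cases h : x = v
  · subst h
    simp
  · have := Ne.symm h
    tauto

/-! ### Upper bound for lexicographic products -/

/-- The layers that are visited before any adjacent layer. -/
noncomputable def freshLayers {ι V : Type*} [LT ι] [Fintype V] (G : SimpleGraph V) (u : ι → V) :
    Finset V :=
  open Classical in {d | ∃ i, u i = d ∧ ∀ j < i, ¬ G.Adj (u j) d}

theorem mem_freshLayers {ι V : Type*} [LT ι] [Fintype V] {G : SimpleGraph V} {u : ι → V} {d : V} :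
    d ∈ freshLayers G u ↔ ∃ i, u i = d ∧ ∀ j < i, ¬ G.Adj (u j) d := by
  simp [freshLayers]

/-- Fresh layers contain at most a Grundy dominating sequence of `H` each, counting a vertex
outside such a layer that footprints what is left of it; any further vertex footprints a new
layer. -/
theorem IsFootprinted.card_le_of_lexProduct {ι V W : Type*} [LinearOrder ι] [Fintype ι]
    [Fintype V] [Finite W] {G : SimpleGraph V} {H : SimpleGraph W} {v x : ι → V × W}
    (h : IsFootprinted (lexProduct G H) v x) :
    ∃ (f : ι → V) (R : Finset ι),
      (∀ i ∈ R, G.Adj (v i).1 (f i) ∧ (∀ j < i, f i ∉ closedNeighborSet G (v j).1) ∧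
        ∃ j < i, G.Adj (v j).1 (v i).1) ∧
      Fintype.card ι ≤
        (freshLayers G fun i => (v i).1).card * grundyDominationNumber H + R.card := by
  classical
  obtain ⟨y, hy, hself⟩ := h.exists_self
  have hmem := hy.mem
  have hnot := hy.notMem
  simp only [mem_closedNeighborSet_lexProduct] at hmem hnot hself
  -- The indices whose footprint lies in another layer, unvisited so far.
  let R : Finset ι := {i | (y i).1 ≠ (v i).1 ∧ ∀ j < i, (v j).1 ≠ (y i).1}
  refine ⟨fun i => (y i).1, R, ?_, ?_⟩
  · intro i hi
    obtain ⟨hi1, hi2⟩ := (Finset.mem_filter.mp hi).2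
    have hadj : G.Adj (v i).1 (y i).1 := (hmem i).resolve_right fun h => hi1 h.1
    have hfar : ∀ j < i, (y i).1 ∉ closedNeighborSet G (v j).1 := fun j hj hc =>
      hc.elim (fun e => hi2 j hj e.symm) fun e => hnot i j hj (Or.inl e)
    refine ⟨hadj, hfar, ?_⟩
    by_contra hcon
    push Not at hcon
    -- If no adjacent layer came earlier, `v i` is undominated, since an earlier vertex of its own
    -- layer would already dominate `y i`. Then `v i` footprints itself.
    refine hi1 (congrArg Prod.fst (hself i fun j hj hc => ?_))
    rcases hc with hc | ⟨hc, -⟩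
    · exact hcon j hj hc
    · exact hfar j hj (Or.inr (hc ▸ hadj))
  · have hRc : Rᶜ.card ≤ grundyDominationNumber H * (freshLayers G fun i => (v i).1).card := by
      refine Finset.card_le_mul_card_image_of_maps_to (f := fun i => (y i).1) ?_ _ ?_
      · intro i hi
        rw [mem_freshLayers]
        have hi' : (y i).1 = (v i).1 ∨ ∃ j < i, (v j).1 = (y i).1 := by
          by_contra hcon
          push Not at hcon
          exact Finset.mem_compl.mp hi (Finset.mem_filter.mpr ⟨Finset.mem_univ i, hcon⟩)
        obtain ⟨l, hl, hvl⟩ : ∃ l ≤ i, (v l).1 = (y i).1 := by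
          rcases hi' with hi' | ⟨j, hj, hj'⟩
          · exact ⟨i, le_rfl, hi'.symm⟩
          · exact ⟨j, hj.le, hj'⟩
        exact ⟨l, hvl, fun j hj hadj => hnot i j (hj.trans_le hl) (Or.inl hadj)⟩
      · intro a _
        let s : Finset ι := {i ∈ Rᶜ | (y i).1 = a}
        have hs : ∀ i : s, (y i).1 = a ∧ ((v i).1 = a ∨ ∃ j < i.1, (v j).1 = a) := by
          rintro ⟨i, hi⟩
          obtain ⟨hiR, rfl⟩ := Finset.mem_filter.mp hi
          refine ⟨rfl, ?_⟩
          by_contra hcon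
          push Not at hcon
          exact Finset.mem_compl.mp hiR
            (Finset.mem_filter.mpr ⟨Finset.mem_univ i, hcon.1.symm, hcon.2⟩)
        -- A vertex from outside layer `a` with a footprint in it dominates all of the layer, so it
        -- is the last index of `s`. Replacing it by its footprint is harmless.
        have hF : IsFootprinted H
            (fun i : s => if (v i).1 = a then (v i).2 else (y i).2) (fun i : s => (y i).2) := by
          refine ⟨fun i => ?_, fun i j hji hc => ?_⟩
          · split_ifs with hi
            · refine ((hmem i).resolve_left fun hadj => ?_).2
              rw [(hs i).1, hi] at hadj
              exact G.irrefl hadj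
            · exact mem_closedNeighborSet_self H _
          · split_ifs at hc with hj
            · exact hnot i j hji (Or.inr ⟨(hs i).1.trans hj.symm, hc⟩)
            · refine hnot i j hji (Or.inl ?_)
              rw [(hs i).1, ← (hs j).1]
              exact (hmem j).resolve_right fun e => hj (e.1.symm.trans (hs j).1)
        simpa using hF.card_le
    have := Finset.card_compl_add_card R
    rw [mul_comm] at hRc
    omega

/-! ### Footprints and gaps in powers of paths -/

/-- Between two consecutive fresh vertices of a power of a path, nothing is visited before the
earlier of them. -/
theorem not_between_of_lt {ι : Type*} [LinearOrder ι] [WellFoundedLT ι] {u : ι → ℕ} {m : ℕ}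
    {i₁ i₂ : ι} (h₁₂ : i₁ < i₂)
    (h₁ : ∀ j < i₁, u j + m < u i₁ ∨ u i₁ + m < u j)
    (h₂ : ∀ j < i₂, u j + m < u i₂ ∨ u i₂ + m < u j)
    (hbtw : ∀ i, (u i₁ < u i ∧ u i < u i₂ ∨ u i₂ < u i ∧ u i < u i₁) →
      ∃ j < i, u j ≤ u i + m ∧ u i ≤ u j + m) (i : ι) (hi : i < i₁) :
    ¬ (u i₁ < u i ∧ u i < u i₂ ∨ u i₂ < u i ∧ u i < u i₁) := by
  -- Infinite descent: `u i` is farther than `m` from both ends, so its earlier neighbour lies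
  -- between them too.
  induction i using WellFoundedLT.induction with
  | ind i ih =>
    intro hcon
    obtain ⟨j, hj, hj'⟩ := hbtw i hcon
    have := ih j hj (hj.trans hi)
    have := h₁ j (hj.trans hi)
    have := h₂ j (hj.trans (hi.trans h₁₂))
    have := h₁ i hi
    have := h₂ i (hi.trans h₁₂)
    omega

/-- The vertices strictly between two consecutive fresh vertices that are within distance `m` of
the earlier one are not footprinted by vertices that are not fresh. -/
theorem ne_footprint_of_between {ι : Type*} [LinearOrder ι] [WellFoundedLT ι] {u f : ι → ℕ} {m : ℕ}
    {i₁ i₂ : ι} (h₁₂ : i₁ < i₂)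
    (h₁ : ∀ j < i₁, u j + m < u i₁ ∨ u i₁ + m < u j)
    (h₂ : ∀ j < i₂, u j + m < u i₂ ∨ u i₂ + m < u j)
    (hbtw : ∀ i, (u i₁ < u i ∧ u i < u i₂ ∨ u i₂ < u i ∧ u i < u i₁) →
      ∃ j < i, u j ≤ u i + m ∧ u i ≤ u j + m)
    {i : ι} (hnear : f i ≤ u i + m ∧ u i ≤ f i + m)
    (hfar : ∀ j < i, u j + m < f i ∨ f i + m < u j)
    (hi : ∃ j < i, u j ≤ u i + m ∧ u i ≤ u j + m)
    (hf : u i₁ < f i ∧ f i < u i₂ ∨ u i₂ < f i ∧ f i < u i₁)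
    (hf' : f i ≤ u i₁ + m ∧ u i₁ ≤ f i + m) : False := by
  -- Once visited, `i₁` dominates `f i`; and `i₁` itself has no earlier neighbour, so `i ≠ i₁`.
  have hii : i < i₁ := by
    rcases lt_trichotomy i i₁ with hlt | rfl | hlt
    · exact hlt
    · obtain ⟨j, hj, hj'⟩ := hi
      have := h₁ j hj
      omega
    · have := hfar i₁ hlt
      omega
  -- Hence `u i` is outside the interval, more than `m` beyond an end, too far to reach `f i`
  -- inside.
  have := not_between_of_lt h₁₂ h₁ h₂ hbtw i hii
  have := h₁ i hii
  have := h₂ i (hii.trans h₁₂)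
  omega

/-- If each element of `A` other than the least has `m` elements of `T` strictly between it and
its predecessor in `A`, then `T` is large. -/
theorem card_mul_lt_card_of_gaps {A T : Finset ℕ} {m : ℕ} (hAT : A ⊆ T)
    (hgap : ∀ a ∈ A, ∀ b ∈ A, a < b → (∀ d ∈ A, ¬ (a < d ∧ d < b)) →
      m ≤ (T.filter fun x => a < x ∧ x < b).card) :
    ∀ b ∈ A, (A.filter (· < b)).card * (m + 1) < (T.filter (· ≤ b)).card := by
  intro b
  induction b using Nat.strong_induction_on with
  | _ b ih =>
    intro hb
    rcases (A.filter (· < b)).eq_empty_or_nonempty with hemp | hne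
    · rw [hemp, Finset.card_empty, zero_mul]
      exact Finset.card_pos.mpr ⟨b, by simp [hAT hb]⟩
    · obtain ⟨a, ha, hmax⟩ := (A.filter (· < b)).exists_max_image id hne
      obtain ⟨haA, hab⟩ := Finset.mem_filter.mp ha
      have hcons : ∀ d ∈ A, ¬ (a < d ∧ d < b) := fun d hd hd' =>
        absurd (hmax d (Finset.mem_filter.mpr ⟨hd, hd'.2⟩)) (not_le.mpr hd'.1)
      have h1 := ih a hab haA
      have h2 := hgap a haA b hb hab hcons
      have h3 : A.filter (· < b) = insert a (A.filter (· < a)) := by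
        ext d
        simp only [Finset.mem_filter, Finset.mem_insert]
        constructor
        · rintro ⟨hd, hdb⟩
          have := hcons d hd
          rcases lt_trichotomy d a with h | h | h
          · exact Or.inr ⟨hd, h⟩
          · exact Or.inl h
          · omega
        · rintro (rfl | ⟨hd, hda⟩)
          · exact ⟨haA, hab⟩
          · exact ⟨hd, hda.trans hab⟩
      have h4 : (A.filter (· < b)).card = (A.filter (· < a)).card + 1 := by
        rw [h3, Finset.card_insert_of_notMem (by simp)]
      have h5 : insert b (T.filter (· ≤ a) ∪ T.filter fun x => a < x ∧ x < b) ⊆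
          T.filter (· ≤ b) := by
        intro d
        simp only [Finset.mem_filter, Finset.mem_insert, Finset.mem_union]
        rintro (rfl | ⟨hd, hda⟩ | ⟨hd, hda⟩)
        · exact ⟨hAT hb, le_rfl⟩
        · exact ⟨hd, hda.trans hab.le⟩
        · exact ⟨hd, hda.2.le⟩
      have h6 := Finset.card_le_card h5
      rw [Finset.card_insert_of_notMem (by simp [hab]), Finset.card_union_of_disjoint] at h6
      · rw [h4, add_mul]
        omega
      · rw [Finset.disjoint_left]
        intro d hd hd'
        have := (Finset.mem_filter.mp hd).2
        have := (Finset.mem_filter.mp hd').2.1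
        omega

theorem card_sub_one_mul_lt_card_of_gaps {A T : Finset ℕ} {m : ℕ} (hA : A.Nonempty) (hAT : A ⊆ T)
    (hgap : ∀ a ∈ A, ∀ b ∈ A, a < b → (∀ d ∈ A, ¬ (a < d ∧ d < b)) →
      m ≤ (T.filter fun x => a < x ∧ x < b).card) :
    (A.card - 1) * (m + 1) < T.card := by
  obtain ⟨b, hb, hmax⟩ := A.exists_max_image id hA
  have h1 := card_mul_lt_card_of_gaps hAT hgap b hb
  have h2 : A.filter (· < b) = A.erase b := by
    ext d
    simp only [Finset.mem_filter, Finset.mem_erase]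
    exact ⟨fun h => ⟨h.2.ne, h.1⟩, fun h => ⟨h.2, lt_of_le_of_ne (hmax d h.2) h.1⟩⟩
  rw [h2, Finset.card_erase_of_mem hb] at h1
  exact h1.trans_le (Finset.card_filter_le _ _)

/-- Choosing the first visit also excludes earlier visits to `d` itself, which turns nonadjacency
into distance greater than `m`. -/
theorem exists_first_of_mem_freshLayers {ι : Type*} [LinearOrder ι] [WellFoundedLT ι] {n m : ℕ}
    {u : ι → Fin n} {d : Fin n} (hd : d ∈ freshLayers (pathPower n m) u) :
    ∃ i, u i = d ∧ ∀ j < i, (u j).1 + m < (u i).1 ∨ (u i).1 + m < (u j).1 := by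
  obtain ⟨i, rfl, hi⟩ := mem_freshLayers.mp hd
  obtain ⟨l, hl, hmin⟩ := WellFounded.has_min (wellFounded_lt (α := ι)) {l | u l = u i} ⟨i, rfl⟩
  refine ⟨l, hl, fun j hj => ?_⟩
  have hli : l ≤ i := not_lt.mp fun h => hmin i rfl h
  have h1 := hi j (hj.trans_le hli)
  have h2 : u j ≠ u i := fun h => hmin j h hj
  rw [pathPower_adj] at h1
  rw [hl]
  have h3 := fun h => h1 ⟨h2, h⟩
  omega

theorem exists_near_of_notMem_freshLayers {ι : Type*} [LT ι] {n m : ℕ}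
    {u : ι → Fin n} {i : ι} (hi : u i ∉ freshLayers (pathPower n m) u) :
    ∃ j < i, (u j).1 ≤ (u i).1 + m ∧ (u i).1 ≤ (u j).1 + m := by
  rw [mem_freshLayers] at hi
  push Not at hi
  obtain ⟨j, hj, hadj⟩ := hi i rfl
  exact ⟨j, hj, (pathPower_adj.mp hadj).2⟩

theorem exists_forall_le_of_fintype (ι : Type*) [LinearOrder ι] [Fintype ι] [Nonempty ι] :
    ∃ o : ι, ∀ i, o ≤ i :=
  ⟨Finset.univ.min' Finset.univ_nonempty, fun i => Finset.min'_le _ _ (Finset.mem_univ i)⟩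

theorem footprint_injOn {ι V : Type*} [LinearOrder ι] {G : SimpleGraph V} {u f : ι → V}
    {R : Finset ι}
    (hR : ∀ i ∈ R, f i ∈ closedNeighborSet G (u i) ∧ ∀ j < i, f i ∉ closedNeighborSet G (u j)) :
    Set.InjOn f R := by
  intro i hi j hj hij
  rcases lt_trichotomy i j with h | h | h
  · exact ((hR j hj).2 i h (hij ▸ (hR i hi).1)).elim
  · exact h
  · exact ((hR i hi).2 j h (hij ▸ (hR j hj).1)).elim

/-- Footprints of vertices other than the first avoid its closed neighbourhood. -/
theorem card_add_lt_of_footprint_pathPower {ι : Type*} [LinearOrder ι] [Fintype ι] [Nonempty ι]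
    {n m : ℕ} (hnm : m + 1 ≤ n) (u f : ι → Fin n) (R : Finset ι)
    (hR : ∀ i ∈ R, (f i ∈ closedNeighborSet (pathPower n m) (u i) ∧
      ∀ j < i, f i ∉ closedNeighborSet (pathPower n m) (u j)) ∧ ∃ j, j < i) :
    R.card + m < n := by
  classical
  obtain ⟨o, hbot⟩ := exists_forall_le_of_fintype ι
  have hF : (R.image fun i => (f i).1).card = R.card :=
    Finset.card_image_of_injOn fun i hi j hj hij =>
      footprint_injOn (fun i hi => (hR i hi).1) hi hj (Fin.ext hij)
  -- The interval is the closed neighbourhood of the first vertex; it has at least `m + 1` elements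
  -- because `m + 1 ≤ n`.
  have hdisj : Disjoint (R.image fun i => (f i).1)
      (Finset.Ico ((u o).1 - m) (min n ((u o).1 + m + 1))) := by
    rw [Finset.disjoint_left]
    intro d hd hd'
    obtain ⟨l, hl, rfl⟩ := Finset.mem_image.mp hd
    obtain ⟨j, hj⟩ := (hR l hl).2
    have := (hR l hl).1.2 o ((hbot j).trans_lt hj)
    rw [mem_closedNeighborSet_pathPower] at this
    rw [Finset.mem_Ico] at hd'
    omega
  have hsub : (R.image fun i => (f i).1) ∪
      Finset.Ico ((u o).1 - m) (min n ((u o).1 + m + 1)) ⊆ Finset.range n := by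
    intro d hd
    rcases Finset.mem_union.mp hd with hd | hd
    · obtain ⟨l, -, rfl⟩ := Finset.mem_image.mp hd
      exact Finset.mem_range.mpr (f l).2
    · rw [Finset.mem_Ico] at hd
      exact Finset.mem_range.mpr (by omega)
  have := Finset.card_le_card hsub
  rw [Finset.card_union_of_disjoint hdisj, hF, Nat.card_Ico, Finset.card_range] at this
  have := (u o).2
  omega

/-- The vertices that are not fresh and footprint a new vertex of `P_n^m` leave room for the fresh
vertices and the gaps between them, and for the closed neighbourhood of the first vertex. -/
theorem card_add_le_of_footprint_pathPower {ι : Type*} [LinearOrder ι] [Fintype ι] [Nonempty ι]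
    {n m : ℕ} (hnm : m + 1 ≤ n) (u f : ι → Fin n) (R : Finset ι)
    (hR : ∀ i ∈ R, (pathPower n m).Adj (u i) (f i) ∧
      (∀ j < i, f i ∉ closedNeighborSet (pathPower n m) (u j)) ∧
        ∃ j < i, (pathPower n m).Adj (u j) (u i)) :
    (freshLayers (pathPower n m) u).Nonempty ∧
    R.card + ((freshLayers (pathPower n m) u).card - 1) * (m + 1) < n ∧ R.card + m < n := by
  classical
  have hinj : Set.InjOn (fun i => (f i).1) R := fun i hi j hj hij =>
    footprint_injOn (fun i hi => ⟨Or.inr (hR i hi).1, (hR i hi).2.1⟩) hi hj (Fin.ext hij)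
  have hnear : ∀ i ∈ R, (f i).1 ≤ (u i).1 + m ∧ (u i).1 ≤ (f i).1 + m := fun i hi =>
    mem_closedNeighborSet_pathPower.mp (Or.inr (hR i hi).1)
  have hfar : ∀ i ∈ R, ∀ j < i, (u j).1 + m < (f i).1 ∨ (f i).1 + m < (u j).1 := by
    intro i hi j hj
    have := (hR i hi).2.1 j hj
    rw [mem_closedNeighborSet_pathPower] at this
    omega
  have hprev : ∀ i ∈ R, ∃ j < i, (u j).1 ≤ (u i).1 + m ∧ (u i).1 ≤ (u j).1 + m := by
    intro i hi
    obtain ⟨j, hj, hadj⟩ := (hR i hi).2.2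
    exact ⟨j, hj, (pathPower_adj.mp hadj).2⟩
  let F : Finset ℕ := R.image fun i => (f i).1
  have hF : F.card = R.card := Finset.card_image_of_injOn hinj
  have hFn : F ⊆ Finset.range n := by
    intro d hd
    obtain ⟨i, -, rfl⟩ := Finset.mem_image.mp hd
    exact Finset.mem_range.mpr (f i).2
  -- `T` must hold the fresh positions and `m` more in each gap between them.
  let T : Finset ℕ := Finset.range n \ F
  have hT : T.card + R.card = n := by
    have := Finset.card_sdiff_add_card_eq_card hFn
    rw [Finset.card_range, hF] at this
    exact this
  let A : Finset ℕ := (freshLayers (pathPower n m) u).image Fin.val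
  have hAcard : A.card = (freshLayers (pathPower n m) u).card :=
    Finset.card_image_of_injective _ Fin.val_injective
  have hA : ∀ a ∈ A, ∃ i, (u i).1 = a ∧
      ∀ j < i, (u j).1 + m < (u i).1 ∨ (u i).1 + m < (u j).1 := by
    intro a ha
    obtain ⟨d, hd, rfl⟩ := Finset.mem_image.mp ha
    obtain ⟨i, rfl, hi⟩ := exists_first_of_mem_freshLayers hd
    exact ⟨i, rfl, hi⟩
  have hnA : ∀ i, (u i).1 ∉ A → ∃ j < i, (u j).1 ≤ (u i).1 + m ∧ (u i).1 ≤ (u j).1 + m :=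
    fun i hi => exists_near_of_notMem_freshLayers fun h => hi (Finset.mem_image_of_mem _ h)
  obtain ⟨o, hbot⟩ := exists_forall_le_of_fintype ι
  have hne : (freshLayers (pathPower n m) u).Nonempty :=
    ⟨u o, mem_freshLayers.mpr ⟨o, rfl, fun j hj => absurd (hbot j) hj.not_ge⟩⟩
  refine ⟨hne, ?_, ?_⟩
  · have hlt : (A.card - 1) * (m + 1) < T.card := by
      refine card_sub_one_mul_lt_card_of_gaps (hne.image _) ?_ ?_
      · intro a ha
        obtain ⟨i, rfl, hi⟩ := hA a ha
        refine Finset.mem_sdiff.mpr ⟨Finset.mem_range.mpr (u i).2, fun hmem => ?_⟩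
        obtain ⟨l, hl, hfl⟩ := Finset.mem_image.mp hmem
        rcases lt_trichotomy i l with h | h | h
        · have := hfar l hl i h
          omega
        · subst h
          exact (pathPower_adj.mp (hR i hl).1).1 (Fin.ext hfl.symm)
        · have := hi l h
          have := hnear l hl
          omega
      · intro a ha b hb hab hcons
        obtain ⟨ia, rfl, hia⟩ := hA a ha
        obtain ⟨ib, rfl, hib⟩ := hA b hb
        have hbtw : ∀ i, (u ia).1 < (u i).1 ∧ (u i).1 < (u ib).1 →
            ∃ j < i, (u j).1 ≤ (u i).1 + m ∧ (u i).1 ≤ (u j).1 + m :=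
          fun i hi => hnA i fun hmem => hcons _ hmem hi
        rcases lt_trichotomy ia ib with h | h | h
        -- The left end is visited first, so the free positions are the `m` to its right; in the
        -- mirrored case they are the `m` to the left of the right end.
        · have hgap := hib ia h
          have hsub : Finset.Ioc (u ia).1 ((u ia).1 + m) ⊆
              T.filter fun x => (u ia).1 < x ∧ x < (u ib).1 := by
            intro d hd
            rw [Finset.mem_Ioc] at hd
            refine Finset.mem_filter.mpr ⟨Finset.mem_sdiff.mpr
              ⟨Finset.mem_range.mpr (by omega), fun hmem => ?_⟩, by omega⟩
            obtain ⟨l, hl, rfl⟩ := Finset.mem_image.mp hmem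
            exact ne_footprint_of_between (u := fun i => (u i).1) (f := fun i => (f i).1) h hia hib
              (fun i hi => hbtw i (by omega)) (hnear l hl) (hfar l hl) (hprev l hl)
              (by omega) (by omega)
          simpa using Finset.card_le_card hsub
        · subst h
          omega
        · have hgap := hia ib h
          have hsub : Finset.Ico ((u ib).1 - m) (u ib).1 ⊆
              T.filter fun x => (u ia).1 < x ∧ x < (u ib).1 := by
            intro d hd
            rw [Finset.mem_Ico] at hd
            refine Finset.mem_filter.mpr ⟨Finset.mem_sdiff.mpr
              ⟨Finset.mem_range.mpr (by omega), fun hmem => ?_⟩, by omega⟩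
            obtain ⟨l, hl, rfl⟩ := Finset.mem_image.mp hmem
            exact ne_footprint_of_between (u := fun i => (u i).1) (f := fun i => (f i).1) h hib hia
              (fun i hi => hbtw i (by omega)) (hnear l hl) (hfar l hl) (hprev l hl)
              (by omega) (by omega)
          have := Finset.card_le_card hsub
          rw [Nat.card_Ico] at this
          omega
    rw [hAcard] at hlt
    omega
  · refine card_add_lt_of_footprint_pathPower hnm u f R fun i hi => ?_
    obtain ⟨hadj, hfar', j, hj, -⟩ := hR i hi
    exact ⟨⟨Or.inr hadj, hfar'⟩, j, hj⟩

/-! ### The extremal family -/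

/-- A footprinted family of `P_n^m`: first `0, …, r`, then in steps of `m + 1` up to `n - 1`. -/
theorem exists_isFootprinted_pathPower {n m q r : ℕ} (hq : 1 ≤ q) (hn : r + (m + 1) * q + 1 = n) :
    ∃ v x : Fin (r + q + 1) → Fin n, IsFootprinted (pathPower n m) v x ∧
      ∀ i, i.1 = 0 ∨ r < i.1 → x i = v i := by
  let p : ℕ → ℕ := fun i => if i ≤ r then i else r + (m + 1) * (i - r)
  -- Positions `1, …, r` footprint their rightmost neighbour, which exists because `q ≥ 1`; position
  -- `0` and the spread-out ones footprint themselves.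
  let y : ℕ → ℕ := fun i => if i = 0 ∨ r < i then p i else i + m
  have hmq : (m + 1) * 1 ≤ (m + 1) * q := Nat.mul_le_mul_left _ hq
  have hp : ∀ i : Fin (r + q + 1), p i.1 < n := by
    intro i
    have : (m + 1) * (i.1 - r) ≤ (m + 1) * q := Nat.mul_le_mul_left _ (by omega)
    simp only [p]
    split_ifs <;> omega
  have hy : ∀ i : Fin (r + q + 1), y i.1 < n := by
    intro i
    simp only [y]
    split_ifs
    · exact hp i
    · omega
  have hstep : ∀ i j : ℕ, j < i → r < i → p j + m < p i := by
    intro i j hji hri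
    have h1 : (m + 1) * 1 ≤ (m + 1) * (i - r) := Nat.mul_le_mul_left _ (by omega)
    have h2 : r < j → (m + 1) * (j - r + 1) ≤ (m + 1) * (i - r) := fun _ =>
      Nat.mul_le_mul_left _ (by omega)
    rw [Nat.mul_succ] at h2
    simp only [p]
    split_ifs <;> omega
  refine ⟨fun i => ⟨p i, hp i⟩, fun i => ⟨y i, hy i⟩, ⟨fun i => ?_, fun i j hji => ?_⟩, ?_⟩
  · rw [mem_closedNeighborSet_pathPower]
    simp only [y, p]
    split_ifs <;> omega
  · rw [mem_closedNeighborSet_pathPower]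
    have hji' : j.1 < i.1 := hji
    have := hstep i j hji'
    simp only [y]
    split_ifs with h
    · omega
    · simp only [p]
      split_ifs <;> omega
  · intro i hi
    exact Fin.ext (if_pos hi)

theorem card_fin_compl_Icc (r q : ℕ) :
    ((Finset.univ.filter fun i : Fin (r + q + 1) => i.1 = 0 ∨ r < i.1)ᶜ).card = r := by
  rw [← Finset.card_map Fin.valEmbedding]
  have : ((Finset.univ.filter fun i : Fin (r + q + 1) => i.1 = 0 ∨ r < i.1)ᶜ).map
      Fin.valEmbedding = Finset.Icc 1 r := by
    ext d
    simp only [Finset.mem_map, Finset.mem_compl, Finset.mem_filter, Finset.mem_univ, true_and,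
      Fin.valEmbedding_apply, Finset.mem_Icc]
    constructor
    · rintro ⟨i, hi, rfl⟩
      omega
    · intro hd
      exact ⟨⟨d, by omega⟩, by dsimp only; omega, rfl⟩
  rw [this, Nat.card_Icc, Nat.add_sub_cancel]

/-! ### Bounds for `P_n^m ∘ H` and the value for `P_n^m` -/

theorem le_grundyDominationNumber_lexProduct_pathPower {W : Type*} [Finite W] [Nonempty W]
    (H : SimpleGraph W) {n m q r : ℕ} (hq : 1 ≤ q) (hn : r + (m + 1) * q + 1 = n) :
    (q + 1) * grundyDominationNumber H + r ≤
      grundyDominationNumber (lexProduct (pathPower n m) H) := by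
  obtain ⟨v, x, hvx, hself⟩ := exists_isFootprinted_pathPower hq hn
  have hle := hvx.lexProduct_le H (Finset.univ.filter fun i => i.1 = 0 ∨ r < i.1)
    fun i hi => hself i (Finset.mem_filter.mp hi).2
  have hcompl := card_fin_compl_Icc r q
  have hadd := Finset.card_add_card_compl
    (Finset.univ.filter fun i : Fin (r + q + 1) => i.1 = 0 ∨ r < i.1)
  rw [hcompl, Fintype.card_fin] at hadd
  rw [hcompl, show (Finset.univ.filter fun i : Fin (r + q + 1) => i.1 = 0 ∨ r < i.1).card = q + 1
    by omega] at hle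
  exact hle

/-- Here `a + 1` counts the fresh layers and `s` the vertices that footprint a new layer. -/
theorem grundyDominationNumber_lexProduct_pathPower_le {W : Type*} [Finite W] [Nonempty W]
    (H : SimpleGraph W) {n m : ℕ} (hnm : m + 1 ≤ n) :
    ∃ a s : ℕ, s + a * (m + 1) < n ∧ s + m < n ∧
      grundyDominationNumber (lexProduct (pathPower n m) H) ≤
        (a + 1) * grundyDominationNumber H + s := by
  have : Nonempty (Fin n) := ⟨⟨0, by omega⟩⟩
  have : NeZero (grundyDominationNumber (lexProduct (pathPower n m) H)) :=
    ⟨(grundyDominationNumber_pos _).ne'⟩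
  obtain ⟨v, x, hvx⟩ := exists_isFootprinted_grundyDominationNumber (lexProduct (pathPower n m) H)
  obtain ⟨f, R, hR, hcard⟩ := hvx.card_le_of_lexProduct
  obtain ⟨hne, h1, h2⟩ := card_add_le_of_footprint_pathPower hnm _ f R hR
  refine ⟨_, _, h1, h2, ?_⟩
  rw [Nat.sub_add_cancel hne.card_pos]
  rwa [Fintype.card_fin] at hcard

theorem grundyDominationNumber_pathPower {n m : ℕ} (hnm : m + 2 ≤ n) :
    grundyDominationNumber (pathPower n m) = n - m := by
  have : Nonempty (Fin n) := ⟨⟨0, by omega⟩⟩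
  have : NeZero (grundyDominationNumber (pathPower n m)) := ⟨(grundyDominationNumber_pos _).ne'⟩
  apply le_antisymm
  · obtain ⟨v, x, hvx⟩ := exists_isFootprinted_grundyDominationNumber (pathPower n m)
    -- Only the first vertex lacks a predecessor, so only its footprint is dropped.
    have := card_add_lt_of_footprint_pathPower (by omega) v x (Finset.univ.erase 0) fun i hi =>
      ⟨⟨hvx.mem i, hvx.notMem i⟩, 0, Fin.pos_iff_ne_zero.mpr (Finset.ne_of_mem_erase hi)⟩
    rw [Finset.card_erase_of_mem (Finset.mem_univ _), Finset.card_univ, Fintype.card_fin] at this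
    omega
  · obtain ⟨v, x, hvx, -⟩ :=
      exists_isFootprinted_pathPower (n := n) (m := m) (q := 1) (r := n - m - 2) le_rfl (by omega)
    have := hvx.card_le
    rw [Fintype.card_fin] at this
    omega

/-! ### Optimising the number of fresh layers -/

theorem ceil_div_succ {n m : ℕ} (hn : 1 ≤ n) :
    ⌈(n : ℚ) / ((m : ℚ) + 1)⌉ = (((n - 1) / (m + 1) : ℕ) : ℤ) + 1 := by
  have h1 := Nat.div_add_mod (n - 1) (m + 1)
  have h2 := Nat.mod_lt (n - 1) (show 0 < m + 1 by omega)
  generalize (n - 1) / (m + 1) = q at *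
  have hpos : (0 : ℚ) < (m : ℚ) + 1 := by positivity
  have h3 : (m + 1) * q < n := by omega
  have h4 : n ≤ (m + 1) * q + (m + 1) := by omega
  rw [Int.ceil_eq_iff, lt_div_iff₀ hpos, div_le_iff₀ hpos]
  have h3' : ((m : ℚ) + 1) * q < n := by exact_mod_cast h3
  have h4' : (n : ℚ) ≤ (m + 1) * q + (m + 1) := by exact_mod_cast h4
  push_cast
  constructor <;> linarith

end GrundyDomination

theorem mainTheorem7 (n m : ℕ) (hnm : m + 2 ≤ n) :
    (∀ {W : Type*} [Finite W] [Nonempty W] (H : SimpleGraph W),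
      (m + 1 ≤ GrundyDomination.grundyDominationNumber H →
        (GrundyDomination.grundyDominationNumber
            (GrundyDomination.lexProduct (GrundyDomination.pathPower n m) H) : ℤ) =
          ⌈(n : ℚ) / ((m : ℚ) + 1)⌉ *
            ((GrundyDomination.grundyDominationNumber H : ℤ) - ((m : ℤ) + 1)) + n + m) ∧
      (GrundyDomination.grundyDominationNumber H ≤ m →
        (GrundyDomination.grundyDominationNumber
            (GrundyDomination.lexProduct (GrundyDomination.pathPower n m) H) : ℤ) =
          2 * (GrundyDomination.grundyDominationNumber H : ℤ) + n - m - 2)) ∧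
    (GrundyDomination.grundyDominationNumber (GrundyDomination.pathPower n m) : ℤ) =
      (n : ℤ) - m := by
  refine ⟨fun {W} _ _ H => ?_, ?_⟩
  · have hk := GrundyDomination.grundyDominationNumber_pos H
    obtain ⟨a, s, h1, h2, hle⟩ :=
      GrundyDomination.grundyDominationNumber_lexProduct_pathPower_le H (show m + 1 ≤ n by omega)
    have hge := fun q r =>
      GrundyDomination.le_grundyDominationNumber_lexProduct_pathPower H (n := n) (m := m)
        (q := q) (r := r)
    generalize GrundyDomination.grundyDominationNumber
      (GrundyDomination.lexProduct (GrundyDomination.pathPower n m) H) = N at *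
    generalize GrundyDomination.grundyDominationNumber H = k at *
    refine ⟨fun hmk => ?_, fun hkm => ?_⟩
    · rw [GrundyDomination.ceil_div_succ (by omega)]
      have hmod := Nat.div_add_mod (n - 1) (m + 1)
      have hq1 : 1 ≤ (n - 1) / (m + 1) := (Nat.one_le_div_iff (by omega)).mpr (by omega)
      have haq : a ≤ (n - 1) / (m + 1) := (Nat.le_div_iff_mul_le (by omega)).mpr (by omega)
      have hlow := hge _ ((n - 1) % (m + 1)) hq1 (by omega)
      generalize (n - 1) / (m + 1) = q at *
      generalize (n - 1) % (m + 1) = r at *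
      -- The surplus `t = k - (m + 1)` is nonnegative, so the upper bound grows with `a ≤ q`.
      obtain ⟨t, rfl⟩ := Nat.exists_eq_add_of_le hmk
      obtain rfl : n = (m + 1) * q + r + 1 := by omega
      have hat : a * t ≤ q * t := Nat.mul_le_mul_right t haq
      push_cast
      zify at *
      apply le_antisymm <;> linarith
    · have hlow := hge 1 (n - m - 2) le_rfl (by omega)
      have hup : N + m + 2 ≤ 2 * k + n := by
        -- For `a = 0` the bound `s + m < n` and `k ≥ 1` suffice; for `a ≥ 1` each fresh layer
        -- beyond the second costs `m + 1 > k`.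
        rcases Nat.eq_zero_or_pos a with rfl | ha
        · omega
        · obtain ⟨b, rfl⟩ : ∃ b, a = 1 + b := Nat.exists_eq_add_of_le ha
          have : b * k ≤ b * (m + 1) := Nat.mul_le_mul_left b (by omega)
          have : (1 + b) * (m + 1) = m + 1 + b * (m + 1) := by ring
          have : (1 + b + 1) * k = 2 * k + b * k := by ring
          omega
      omega
  · rw [GrundyDomination.grundyDominationNumber_pathPower hnm]
    omega
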